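/- Let $n\ge 1$, $X\in\mathbb R^{n\times d}$, $y\in\mathbb R^n$, $\beta\ge 0$ and $\delta>0$. For $u\in\mathbb R^d$ let $D(u)=\mathrm{diag}(\mathbf 1[Xu\ge 0])$ (entrywise), and let $D_1,\dots,D_P$ be all the distinct matrices of the form $D(u)$, $u\in\mathbb R^d$. For $g\sim\mathcal N(0,I_d)$ put $$\mathcal M=\mathbb E\big[D(g)XX^{T}D(g)\big],$$ assume that $\mathcal M$ is invertible, and let $$\kappa=\frac{\lambda_{\max}(XX^T)}{\lambda_{\min}(\mathcal M)},\qquad \mathcal M_i=D_iXX^TD_i\ (i\in[P]),\qquad G=1-\frac{\beta}{2\max_{i\in[P]}\sqrt{y^T\mathcal M_iy}}.$$ Let $g_1,\dots,g_{\tilde P}\sim\mathcal N(0,I_d)$ be independent, where $\tilde P\ge 8\kappa\log(n/\delta)$, and let $\tilde D_i=D(g_i)$. Define the optimal values $$p_1^*=\inf_{w_1,\dots,w_P\in\mathbb R^d}\ \frac12\Big\|\sum_{i=1}^{P}D_iXw_i-y\Big\|_2^2+\beta\sum_{i=1}^{P}\|w_i\|_2,$$ $$\tilde p_1^*=\inf_{w_1,\dots,w_{\tilde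 P}\in\mathbb R^d}\ \frac12\Big\|\sum_{i=1}^{\tilde P}\tilde D_iXw_i-y\Big\|_2^2+\beta\sum_{i=1}^{\tilde P}\|w_i\|_2.$$ Then with probability at least $1-\delta$ both of the following hold: $$0\le\tilde p_1^*-p_1^*\le\sqrt2\,\beta\,\frac{\|y\|_2}{\sqrt{\lambda_{\min}(\mathcal M)}},$$ and, provided that $\beta<2\max_{i\in[P]}\sqrt{y^T\mathcal M_iy}$ (that is, $G$ is well defined and positive), $$p_1^*\le\tilde p_1^*\le\frac{\sqrt{2\kappa}}{G}\,p_1^*.$$ -/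

import Mathlib

open MeasureTheory ProbabilityTheory

noncomputable section

namespace GatedReLU

variable {n d : ℕ}

/-- The activation pattern `diag(𝟙[X u ≥ 0])` of the vector `u` on the data matrix `X`. -/
def pattern (X : Matrix (Fin n) (Fin d) ℝ) (u : EuclideanSpace ℝ (Fin d)) :
    Matrix (Fin n) (Fin n) ℝ :=
  Matrix.diagonal fun i => if 0 ≤ X.mulVec u.ofLp i then 1 else 0

/-- The set `{D_1, …, D_P}` of all possible (pairwise distinct) hyperplane arrangement patterns
of `X`. -/
def allPatterns (X : Matrix (Fin n) (Fin d) ℝ) : Set (Matrix (Fin n) (Fin n) ℝ) :=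
  Set.range (pattern X)

theorem allPatterns_finite (X : Matrix (Fin n) (Fin d) ℝ) : (allPatterns X).Finite := by
  refine (Set.finite_range fun s : Fin n → Bool =>
    (Matrix.diagonal fun i => if s i = true then (1 : ℝ) else 0)).subset ?_
  rintro _ ⟨u, rfl⟩
  exact ⟨fun i => decide (0 ≤ X.mulVec u.ofLp i), by simp [pattern]⟩

instance (X : Matrix (Fin n) (Fin d) ℝ) : Fintype (allPatterns X) :=
  (allPatterns_finite X).fintype

/-- The group-`ℓ¹` regularized objective
`½ ‖∑ i, D_i X w_i - y‖₂² + β ∑ i, ‖w_i‖₂` for a finite family `D` of patterns. -/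
def objective {ι : Type*} [Fintype ι] (X : Matrix (Fin n) (Fin d) ℝ)
    (y : EuclideanSpace ℝ (Fin n)) (β : ℝ) (D : ι → Matrix (Fin n) (Fin n) ℝ)
    (w : ι → EuclideanSpace ℝ (Fin d)) : ℝ :=
  1 / 2 * ‖(∑ i, WithLp.toLp 2 ((D i * X).mulVec (w i).ofLp)) - y‖ ^ 2 + β * ∑ i, ‖w i‖

/-- The optimal value of the unconstrained group-`ℓ¹` problem over a finite family of patterns. -/
def optValue {ι : Type*} [Fintype ι] (X : Matrix (Fin n) (Fin d) ℝ)
    (y : EuclideanSpace ℝ (Fin n)) (β : ℝ) (D : ι → Matrix (Fin n) (Fin n) ℝ) : ℝ :=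
  ⨅ w : ι → EuclideanSpace ℝ (Fin d), objective X y β D w

/-- The optimal value `p₁*` with all possible patterns, each used once. -/
def fullValue (X : Matrix (Fin n) (Fin d) ℝ) (y : EuclideanSpace ℝ (Fin n)) (β : ℝ) : ℝ :=
  optValue X y β (fun D : allPatterns X => (D : Matrix (Fin n) (Fin n) ℝ))

/-- The optimal value `p̃₁*` with the patterns of the vectors `g_1, …, g_m`. -/
def sampledValue {m : ℕ} (X : Matrix (Fin n) (Fin d) ℝ) (y : EuclideanSpace ℝ (Fin n)) (β : ℝ)
    (g : Fin m → EuclideanSpace ℝ (Fin d)) : ℝ :=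
  optValue X y β (fun i => pattern X (g i))

/-- The matrix `D X Xᵀ D`. -/
def gram (X : Matrix (Fin n) (Fin d) ℝ) (D : Matrix (Fin n) (Fin n) ℝ) :
    Matrix (Fin n) (Fin n) ℝ :=
  D * X * X.transpose * D

/-- The entrywise expectation `𝓜 = 𝔼[D(g) X Xᵀ D(g)]`, `g ∼ 𝒩(0, I_d)`. -/
def meanGram (X : Matrix (Fin n) (Fin d) ℝ) : Matrix (Fin n) (Fin n) ℝ :=
  Matrix.of fun i j =>
    ∫ g, gram X (pattern X g) i j ∂(stdGaussian (EuclideanSpace ℝ (Fin d)))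

/-- The smallest eigenvalue of a real symmetric matrix of positive size. -/
def lambdaMin (A : Matrix (Fin n) (Fin n) ℝ) : ℝ := sInf (spectrum ℝ A)

/-- The largest eigenvalue of a real symmetric matrix of positive size. -/
def lambdaMax (A : Matrix (Fin n) (Fin n) ℝ) : ℝ := sSup (spectrum ℝ A)

/-- `κ = λ_max(X Xᵀ) / λ_min(𝓜)`. -/
def kappa (X : Matrix (Fin n) (Fin d) ℝ) : ℝ :=
  lambdaMax (X * X.transpose) / lambdaMin (meanGram X)

/-- `max_i √(yᵀ 𝓜_i y)` over all possible patterns, where `𝓜_i = D_i X Xᵀ D_i`. -/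
def maxGram (X : Matrix (Fin n) (Fin d) ℝ) (y : EuclideanSpace ℝ (Fin n)) : ℝ :=
  ⨆ D : allPatterns X, √(dotProduct y.ofLp ((gram X D).mulVec y.ofLp))

/-- `G = 1 - β / (2 max_i √(yᵀ 𝓜_i y))`. -/
def G (X : Matrix (Fin n) (Fin d) ℝ) (y : EuclideanSpace ℝ (Fin n)) (β : ℝ) : ℝ :=
  1 - β / (2 * maxGram X y)

end GatedReLU

end

/-!
The first upper bound only uses `0 ≤ p₁*` and a feasible point for the sampled problem. If
`S = ∑ i, M̃_i`, the sum of the sampled Gram matrices, satisfies `S ≥ (m λ / 2) • 1` with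
`λ = λ_min(𝓜)`, then the weights `w_i = Xᵀ D̃_i S⁻¹ y` fit `y` exactly, and by Cauchy-Schwarz
`∑ i, ‖w_i‖ ≤ √(m yᵀ S⁻¹ y) ≤ √2 ‖y‖ / √λ` (`sampledValue_le`). For the multiplicative bound, a
multiple `c • y` of the labels is dual feasible for the full problem when `c = β / max √(yᵀ 𝓜_i y)`,
so that `p₁* ≥ G β ‖y‖ / √λ_max(X Xᵀ)` (`le_fullValue`). The inequality `p₁* ≤ p̃₁*` holds because
repeated patterns can be merged by the triangle inequality (`optValue_le_optValue_comp`).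

It remains to bound `S` from below with probability `1 - δ`, by a matrix Chernoff bound
(`matrix_chernoff_lower_tail`). Instead of the Golden-Thompson inequality, its proof uses a one-step
estimate for the trace exponential (`Matrix.trace_exp_sub_le`): if `Y ≥ 0` and `Y² ≤ r Y`, then
`tr e^{B - Y} ≤ tr e^B - (1 - r / 2) tr (Y e^B)`. Since `tr (F(A) G(B)) = ∑ i j, w i j F(a i) G(b j)`
with the same nonnegative weights for all functions `F`, `G` of symmetric matrices `A`, `B`, this
follows from two inequalities between real exponentials. The right-hand side is linear in the
last summand `Y`, so that its expectation given the other summands is immediate, and induction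
bounds `𝔼 tr exp (-θ S)`. The choice `θ = 1 / (2 λ_max(X Xᵀ))` yields the constant `8`.
-/

open scoped Matrix

/-! ### A second-order inequality for the exponential -/

/-- The second-order Taylor term is split between the endpoints in the proportion `1/3 : 1/6`, the only
one for which the third-order terms cancel, so that the inequality holds for both signs of `b - a`. -/
theorem Real.exp_le_exp_second_order (a b : ℝ) :
    Real.exp a ≤ Real.exp b - (b - a) * Real.exp b + 1 / 3 * ((b - a) ^ 2 * Real.exp b) +
      1 / 6 * ((b - a) ^ 2 * Real.exp a) := by
  -- With `t = b - a` this says that `f` below is nonnegative; it is minimal at `t = 0`.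
  set f : ℝ → ℝ := fun t => Real.exp t * (1 - t + t ^ 2 / 3) + t ^ 2 / 6 - 1 with hf
  have hd : ∀ t, HasDerivAt f (t / 3 * (Real.exp t * (t - 1) + 1)) t := by
    intro t
    have h1 : HasDerivAt (fun t : ℝ => 1 - t + t ^ 2 / 3) (-1 + 2 * t / 3) t := by
      simpa using ((hasDerivAt_id' t).const_sub 1).fun_add ((hasDerivAt_pow 2 t).div_const 3)
    have h2 : HasDerivAt (fun t : ℝ => t ^ 2 / 6) (2 * t / 6) t := by
      simpa using (hasDerivAt_pow 2 t).div_const 6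
    refine ((((Real.hasDerivAt_exp t).fun_mul h1).fun_add h2).sub_const 1).congr_deriv ?_
    ring
  have hg : ∀ t : ℝ, 0 ≤ Real.exp t * (t - 1) + 1 := by
    intro t
    have h := Real.add_one_le_exp (-t)
    have h' := mul_le_mul_of_nonneg_left h (Real.exp_pos t).le
    rw [← Real.exp_add, add_neg_cancel, Real.exp_zero] at h'
    linarith
  have hcont : Continuous f := by
    rw [hf]; fun_prop
  have h0 : f 0 = 0 := by simp [hf]
  have key : ∀ t, 0 ≤ f t := by
    intro t
    rcases le_total 0 t with ht | ht
    · have : MonotoneOn f (Set.Ici 0) := by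
        refine monotoneOn_of_deriv_nonneg (convex_Ici 0) hcont.continuousOn
          (fun x _ => (hd x).differentiableAt.differentiableWithinAt) fun x hx => ?_
        rw [(hd x).deriv]
        rw [interior_Ici] at hx
        exact mul_nonneg (div_nonneg hx.le (by norm_num)) (hg x)
      rw [← h0]
      exact this Set.self_mem_Ici ht ht
    · have : AntitoneOn f (Set.Iic 0) := by
        refine antitoneOn_of_deriv_nonpos (convex_Iic 0) hcont.continuousOn
          (fun x _ => (hd x).differentiableAt.differentiableWithinAt) fun x hx => ?_
        rw [(hd x).deriv]
        rw [interior_Iic] at hx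
        exact mul_nonpos_of_nonpos_of_nonneg
          (div_nonpos_of_nonpos_of_nonneg (le_of_lt hx) (by norm_num)) (hg x)
      rw [← h0]
      exact this ht Set.self_mem_Iic ht
  have h := mul_nonneg (Real.exp_pos a).le (key (b - a))
  have hb : Real.exp a * Real.exp (b - a) = Real.exp b := by rw [← Real.exp_add]; ring_nf
  simp only [hf] at h
  rw [← hb]
  linarith

theorem Real.sub_mul_exp_le (a b : ℝ) : (b - a) * Real.exp a ≤ (b - a) * Real.exp b := by
  rcases le_total a b with h | h
  · exact mul_le_mul_of_nonneg_left (Real.exp_le_exp.2 h) (by linarith)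
  · exact mul_le_mul_of_nonpos_left (Real.exp_le_exp.2 h) (by linarith)

/-! ### The trace exponential of a perturbed symmetric matrix -/

namespace Matrix

variable {ι : Type*} [Fintype ι] [DecidableEq ι]

/-- For orthogonal `U`, `V` this is the double spectral sum: the weights `((star U * V) i j) ^ 2` do not
depend on the functions of the eigenvalues `p` and `q`. -/
theorem trace_conj_diagonal_mul_conj_diagonal (U V : Matrix ι ι ℝ) (p q : ι → ℝ) :
    ((U * diagonal p * star U) * (V * diagonal q * star V)).trace =
      ∑ i, ∑ j, p i * q j * ((star U * V) i j) ^ 2 := by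
  have h : ((U * diagonal p * star U) * (V * diagonal q * star V)).trace =
      (diagonal p * ((star U * V) * diagonal q * star (star U * V))).trace := by
    rw [star_mul, star_star, Matrix.mul_assoc U, Matrix.mul_assoc U, Matrix.trace_mul_comm U]
    simp only [Matrix.mul_assoc]
  rw [h]
  simp only [trace, diag_apply, diagonal_mul]
  refine Finset.sum_congr rfl fun i _ => ?_
  rw [Matrix.mul_apply, Finset.mul_sum]
  refine Finset.sum_congr rfl fun j _ => ?_
  rw [mul_diagonal, star_apply (star U * V), star_trivial ((star U * V) i j)]
  ring

theorem PosSemidef.trace_mul_conj_diagonal_nonneg {P : Matrix ι ι ℝ} (hP : P.PosSemidef)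
    (V : Matrix ι ι ℝ) {q : ι → ℝ} (hq : ∀ i, 0 ≤ q i) :
    0 ≤ (P * (V * diagonal q * star V)).trace := by
  have h : (P * (V * diagonal q * star V)).trace = ((Vᴴ * P * V) * diagonal q).trace := by
    rw [← Matrix.mul_assoc, Matrix.trace_mul_comm]
    simp only [Matrix.mul_assoc, star_eq_conjTranspose]
  rw [h]
  simp only [trace, diag_apply, mul_diagonal]
  exact Finset.sum_nonneg fun i _ =>
    mul_nonneg (hP.conjTranspose_mul_mul_same V).diag_nonneg (hq i)

theorem exp_smul_conj_diagonal (U : unitaryGroup ι ℝ) (c : ℝ) (a : ι → ℝ) :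
    NormedSpace.exp (c • ((U : Matrix ι ι ℝ) * diagonal a * star (U : Matrix ι ι ℝ))) =
      (U : Matrix ι ι ℝ) * diagonal (fun i => Real.exp (c * a i)) * star (U : Matrix ι ι ℝ) := by
  have hinv : (U : Matrix ι ι ℝ)⁻¹ = star (U : Matrix ι ι ℝ) :=
    Matrix.inv_eq_right_inv (Unitary.coe_mul_star_self U)
  have hU : IsUnit (U : Matrix ι ι ℝ) := Unitary.isUnit_coe
  have h := Matrix.exp_conj (U : Matrix ι ι ℝ) (diagonal (c • a)) hU
  rw [hinv, exp_diagonal] at h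
  rw [show c • ((U : Matrix ι ι ℝ) * diagonal a * star (U : Matrix ι ι ℝ)) =
    (U : Matrix ι ι ℝ) * diagonal (c • a) * star (U : Matrix ι ι ℝ) by
      rw [diagonal_smul, Matrix.mul_smul, Matrix.smul_mul], h]
  congr 3
  funext i
  simp [NormedSpace.exp, Pi.coe_exp, Real.exp_eq_exp_ℝ]

theorem IsHermitian.eq_conj_diagonal {A : Matrix ι ι ℝ} (hA : A.IsHermitian) :
    A = (hA.eigenvectorUnitary : Matrix ι ι ℝ) * diagonal hA.eigenvalues *
      star (hA.eigenvectorUnitary : Matrix ι ι ℝ) := by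
  conv_lhs => rw [hA.spectral_theorem]
  rfl

theorem IsHermitian.exp_smul_eq {A : Matrix ι ι ℝ} (hA : A.IsHermitian) (c : ℝ) :
    NormedSpace.exp (c • A) = (hA.eigenvectorUnitary : Matrix ι ι ℝ) *
      diagonal (fun i => Real.exp (c * hA.eigenvalues i)) *
      star (hA.eigenvectorUnitary : Matrix ι ι ℝ) := by
  conv_lhs => rw [hA.eq_conj_diagonal]
  exact exp_smul_conj_diagonal _ _ _

theorem IsHermitian.trace_exp_smul {A : Matrix ι ι ℝ} (hA : A.IsHermitian) (c : ℝ) :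
    (NormedSpace.exp (c • A)).trace = ∑ i, Real.exp (c * hA.eigenvalues i) := by
  rw [hA.exp_smul_eq, Matrix.trace_mul_comm, ← Matrix.mul_assoc, Unitary.coe_star_mul_self,
    Matrix.one_mul, trace_diagonal]

theorem PosSemidef.trace_mul_exp_nonneg {P H : Matrix ι ι ℝ} (hP : P.PosSemidef)
    (hH : H.IsHermitian) : 0 ≤ (P * NormedSpace.exp H).trace := by
  rw [← one_smul ℝ H, hH.exp_smul_eq]
  exact hP.trace_mul_conj_diagonal_nonneg _ fun i => (Real.exp_pos _).le

/-- A first-order upper bound for the trace exponential, linear in `Y` and valid for noncommuting `B`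
and `Y`. It takes the place of the Golden-Thompson inequality in the Chernoff bound. -/
theorem trace_exp_sub_le {B Y : Matrix ι ι ℝ} (hB : B.IsHermitian) (hY : Y.PosSemidef) {r : ℝ}
    (hr0 : 0 ≤ r) (hr : (r • Y - Y * Y).PosSemidef) :
    (NormedSpace.exp (B - Y)).trace ≤ (NormedSpace.exp B).trace -
      (1 - r / 2) * (Y * NormedSpace.exp B).trace := by
  obtain ⟨A, hA⟩ : ∃ A, A = B - Y := ⟨_, rfl⟩
  have hAH : A.IsHermitian := hA ▸ hB.sub hY.isHermitian
  obtain rfl : Y = B - A := by rw [hA]; abel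
  rw [← hA]
  have hsqB := hr.trace_mul_exp_nonneg hB
  have hsqA := hr.trace_mul_exp_nonneg hAH
  set U := (hAH.eigenvectorUnitary : Matrix ι ι ℝ)
  set V := (hB.eigenvectorUnitary : Matrix ι ι ℝ)
  have hUU : star U * U = 1 := Unitary.coe_star_mul_self _
  have hVV : star V * V = 1 := Unitary.coe_star_mul_self _
  have hUU' : U * star U = 1 := Unitary.coe_mul_star_self _
  have hVV' : V * star V = 1 := Unitary.coe_mul_star_self _
  set a := hAH.eigenvalues
  set b := hB.eigenvalues
  -- `P p` and `Q q` are the functions of `A` and of `B` with eigenvalues `p` and `q`.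
  let P : (ι → ℝ) → Matrix ι ι ℝ := fun p => U * diagonal p * star U
  let Q : (ι → ℝ) → Matrix ι ι ℝ := fun q => V * diagonal q * star V
  have hP1 : P 1 = 1 := by simp [P, hUU']
  have hQ1 : Q 1 = 1 := by simp [Q, hVV']
  have hPm : ∀ p p', P p * P p' = P (p * p') := by
    intro p p'
    calc P p * P p' = U * diagonal p * (star U * U) * diagonal p' * star U := by
          simp only [P, Matrix.mul_assoc]
      _ = P (p * p') := by
          rw [hUU, Matrix.mul_one, Matrix.mul_assoc U, diagonal_mul_diagonal]; rfl
  have hQm : ∀ p p', Q p * Q p' = Q (p * p') := by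
    intro p p'
    calc Q p * Q p' = V * diagonal p * (star V * V) * diagonal p' * star V := by
          simp only [Q, Matrix.mul_assoc]
      _ = Q (p * p') := by
          rw [hVV, Matrix.mul_one, Matrix.mul_assoc V, diagonal_mul_diagonal]; rfl
  let ea : ι → ℝ := fun i => Real.exp (a i)
  let eb : ι → ℝ := fun i => Real.exp (b i)
  have eA : A = P a := hAH.eq_conj_diagonal
  have eB : B = Q b := hB.eq_conj_diagonal
  have eEA : NormedSpace.exp A = P ea := by simpa using hAH.exp_smul_eq 1
  have eEB : NormedSpace.exp B = Q eb := by simpa using hB.exp_smul_eq 1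
  let w : ι → ι → ℝ := fun i j => ((star U * V) i j) ^ 2
  have hw : ∀ i j, 0 ≤ w i j := fun i j => sq_nonneg _
  have tr : ∀ p q, (P p * Q q).trace = ∑ i, ∑ j, p i * q j * w i j :=
    fun p q => trace_conj_diagonal_mul_conj_diagonal U V p q
  have trA : (NormedSpace.exp A).trace = ∑ i, ∑ j, w i j * Real.exp (a i) := by
    rw [eEA, ← Matrix.mul_one (P ea), ← hQ1, tr]
    simp [ea, mul_comm]
  have trB : (NormedSpace.exp B).trace = ∑ i, ∑ j, w i j * Real.exp (b j) := by
    rw [eEB, ← Matrix.one_mul (Q eb), ← hP1, tr]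
    simp [eb, mul_comm]
  have trYB : ((B - A) * NormedSpace.exp B).trace =
      ∑ i, ∑ j, w i j * ((b j - a i) * Real.exp (b j)) := by
    have e : ((B - A) * NormedSpace.exp B).trace =
        (P 1 * Q (b * eb)).trace - (P a * Q eb).trace := by
      rw [← hQm, hP1, ← eA, ← eB, ← eEB, Matrix.one_mul, Matrix.sub_mul, trace_sub]
    rw [e, tr, tr]
    simp only [← Finset.sum_sub_distrib]
    refine Finset.sum_congr rfl fun i _ => Finset.sum_congr rfl fun j _ => ?_
    simp only [eb, Pi.mul_apply, Pi.one_apply]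
    ring
  have trYA : ((B - A) * NormedSpace.exp A).trace =
      ∑ i, ∑ j, w i j * ((b j - a i) * Real.exp (a i)) := by
    have e : ((B - A) * NormedSpace.exp A).trace =
        (P ea * Q b).trace - (P (ea * a) * Q 1).trace := by
      rw [← hPm, hQ1, ← eA, ← eB, ← eEA, Matrix.mul_one, trace_mul_comm, Matrix.mul_sub, trace_sub]
    rw [e, tr, tr]
    simp only [← Finset.sum_sub_distrib]
    refine Finset.sum_congr rfl fun i _ => Finset.sum_congr rfl fun j _ => ?_
    simp only [ea, Pi.mul_apply, Pi.one_apply]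
    ring
  have trYYB : ((B - A) * (B - A) * NormedSpace.exp B).trace =
      ∑ i, ∑ j, w i j * ((b j - a i) ^ 2 * Real.exp (b j)) := by
    have e : ((B - A) * (B - A) * NormedSpace.exp B).trace =
        (P 1 * Q (b * (b * eb))).trace - (P a * Q (eb * b)).trace - (P a * Q (b * eb)).trace +
          (P (a * a) * Q eb).trace := by
      rw [← hPm, ← hQm, ← hQm, ← hQm, hP1, ← eA, ← eB, ← eEB, Matrix.one_mul,
        ← Matrix.mul_assoc A _ B, Matrix.trace_mul_comm _ B]
      simp only [Matrix.sub_mul, Matrix.mul_sub, trace_sub, Matrix.mul_assoc]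
      ring
    rw [e, tr, tr, tr, tr]
    simp only [← Finset.sum_sub_distrib, ← Finset.sum_add_distrib]
    refine Finset.sum_congr rfl fun i _ => Finset.sum_congr rfl fun j _ => ?_
    simp only [eb, Pi.mul_apply, Pi.one_apply]
    ring
  have trYYA : ((B - A) * (B - A) * NormedSpace.exp A).trace =
      ∑ i, ∑ j, w i j * ((b j - a i) ^ 2 * Real.exp (a i)) := by
    have e : ((B - A) * (B - A) * NormedSpace.exp A).trace =
        (P ea * Q (b * b)).trace - (P (a * ea) * Q b).trace - (P (ea * a) * Q b).trace +
          (P (a * (a * ea)) * Q 1).trace := by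
      rw [← hPm a (a * ea), ← hQm, ← hPm a ea, ← hPm ea a, hQ1, ← eA, ← eB, ← eEA, Matrix.mul_one,
        Matrix.trace_mul_comm _ (B * B), Matrix.trace_mul_comm _ B,
        Matrix.mul_assoc _ A B, Matrix.trace_mul_comm _ (A * B)]
      simp only [Matrix.sub_mul, Matrix.mul_sub, trace_sub, Matrix.mul_assoc]
      ring
    rw [e, tr, tr, tr, tr]
    simp only [← Finset.sum_sub_distrib, ← Finset.sum_add_distrib]
    refine Finset.sum_congr rfl fun i _ => Finset.sum_congr rfl fun j _ => ?_
    simp only [ea, Pi.mul_apply, Pi.one_apply]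
    ring
  have main : (NormedSpace.exp A).trace ≤ (NormedSpace.exp B).trace -
      ((B - A) * NormedSpace.exp B).trace +
      1 / 3 * ((B - A) * (B - A) * NormedSpace.exp B).trace +
      1 / 6 * ((B - A) * (B - A) * NormedSpace.exp A).trace := by
    rw [trA, trB, trYB, trYYB, trYYA]
    simp only [Finset.mul_sum, ← Finset.sum_sub_distrib, ← Finset.sum_add_distrib]
    refine Finset.sum_le_sum fun i _ => Finset.sum_le_sum fun j _ => ?_
    have := mul_le_mul_of_nonneg_left (Real.exp_le_exp_second_order (a i) (b j)) (hw i j)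
    linarith
  -- The two second-order terms are `≤ r tr (Y e^B)` and `≤ r tr (Y e^A)`; by monotonicity of `exp`,
  -- the latter trace is at most `tr (Y e^B)` as well.
  have mono : ((B - A) * NormedSpace.exp A).trace ≤ ((B - A) * NormedSpace.exp B).trace := by
    rw [trYA, trYB]
    exact Finset.sum_le_sum fun i _ => Finset.sum_le_sum fun j _ =>
      mul_le_mul_of_nonneg_left (Real.sub_mul_exp_le _ _) (hw i j)
  rw [Matrix.sub_mul, trace_sub, Matrix.smul_mul, trace_smul, smul_eq_mul] at hsqA hsqB
  have := mul_le_mul_of_nonneg_left mono hr0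
  linarith

/-- If `0 ≤ Z ≤ R` then `Z² ≤ R Z`, because `R (R Z - Z²) = Z (R - Z) Z + (R - Z) Z (R - Z)`. -/
theorem PosSemidef.smul_sub_mul_self {Z : Matrix ι ι ℝ} {R : ℝ} (hR : 0 < R) (hZ : Z.PosSemidef)
    (hZR : (R • (1 : Matrix ι ι ℝ) - Z).PosSemidef) : (R • Z - Z * Z).PosSemidef := by
  have h1 : (Z * (R • (1 : Matrix ι ι ℝ) - Z) * Z).PosSemidef := by
    simpa only [hZ.isHermitian.eq] using hZR.conjTranspose_mul_mul_same Z
  have h2 : ((R • (1 : Matrix ι ι ℝ) - Z) * Z * (R • (1 : Matrix ι ι ℝ) - Z)).PosSemidef := by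
    simpa only [hZR.isHermitian.eq] using hZ.conjTranspose_mul_mul_same (R • (1 : Matrix ι ι ℝ) - Z)
  have e : R • Z - Z * Z = R⁻¹ • (Z * (R • (1 : Matrix ι ι ℝ) - Z) * Z +
      (R • (1 : Matrix ι ι ℝ) - Z) * Z * (R • (1 : Matrix ι ι ℝ) - Z)) := by
    rw [eq_inv_smul_iff₀ hR.ne']
    simp only [Matrix.mul_sub, Matrix.sub_mul, Matrix.mul_smul, Matrix.smul_mul, Matrix.mul_one,
      Matrix.one_mul, Matrix.mul_assoc, smul_sub]
    abel
  rw [e]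
  exact (h1.add h2).smul (inv_nonneg.2 hR.le)

theorem IsHermitian.posSemidef_smul_add {A : Matrix ι ι ℝ} (hA : A.IsHermitian) {c t : ℝ}
    (h : ∀ i, 0 ≤ c * hA.eigenvalues i + t) : (c • A + t • (1 : Matrix ι ι ℝ)).PosSemidef := by
  set U := (hA.eigenvectorUnitary : Matrix ι ι ℝ)
  have e : c • A + t • (1 : Matrix ι ι ℝ) =
      U * Matrix.diagonal (fun i => c * hA.eigenvalues i + t) * Uᴴ := by
    conv_lhs => rw [hA.eq_conj_diagonal]
    have h1 : U * star U = 1 := Unitary.coe_mul_star_self _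
    have h2 : Matrix.diagonal (fun i => c * hA.eigenvalues i + t) =
        c • Matrix.diagonal hA.eigenvalues + t • (1 : Matrix ι ι ℝ) := by
      rw [Matrix.smul_one_eq_diagonal, ← Matrix.diagonal_smul, Matrix.diagonal_add]
      rfl
    rw [h2, Matrix.mul_add, Matrix.add_mul, ← Matrix.star_eq_conjTranspose, Matrix.mul_smul,
      Matrix.smul_mul, Matrix.mul_smul, Matrix.smul_mul, Matrix.mul_one, h1]
  rw [e]
  exact (Matrix.PosSemidef.diagonal fun i => h i).mul_mul_conjTranspose_same U

/-- If `A ≥ t` fails, then some eigenvalue of `A` is below `t`, and its term alone makes the trace of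
`exp (-θ A)` at least `exp (-θ t)`. -/
theorem IsHermitian.posSemidef_sub_or_exp_le_trace {A : Matrix ι ι ℝ} (hA : A.IsHermitian)
    (t : ℝ) {θ : ℝ} (hθ : 0 ≤ θ) : (A - t • (1 : Matrix ι ι ℝ)).PosSemidef ∨
      Real.exp (-θ * t) ≤ (NormedSpace.exp (-θ • A)).trace := by
  by_cases h : ∀ i, t ≤ hA.eigenvalues i
  · left
    have := hA.posSemidef_smul_add (c := 1) (t := -t) fun i => by linarith [h i]
    rwa [one_smul, neg_smul, ← sub_eq_add_neg] at this
  · right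
    push Not at h
    obtain ⟨i, hi⟩ := h
    rw [hA.trace_exp_smul]
    refine le_trans ?_ (Finset.single_le_sum (fun j _ => (Real.exp_pos _).le) (Finset.mem_univ i))
    exact Real.exp_le_exp.2 (by nlinarith)

end Matrix

/-! ### A matrix Chernoff bound -/

namespace ProbabilityTheory

variable {ι κ S Ω : Type*} [Fintype ι] [Finite S] [MeasurableSpace S]
  [MeasurableSingletonClass S] [MeasurableSpace Ω] {μ : Measure Ω} [IsProbabilityMeasure μ]

theorem integrable_comp_of_finite {σ : Ω → S} (hσ : AEMeasurable σ μ) (F : S → ℝ) :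
    Integrable (fun ω => F (σ ω)) μ :=
  (Integrable.of_finite (μ := μ.map σ) (f := F)).comp_aemeasurable hσ

/-- In the expected trace of a product, a factor independent of the other one may be replaced by its
mean. -/
theorem integral_trace_mul_of_indepFun {T : Type*} [Finite T] [MeasurableSpace T]
    [MeasurableSingletonClass T] {σ : Ω → S} {τ : Ω → T} (hσ : AEMeasurable σ μ)
    (hτ : AEMeasurable τ μ) (h : IndepFun σ τ μ) (Z : S → Matrix ι ι ℝ) (E : T → Matrix ι ι ℝ)
    {M : Matrix ι ι ℝ} (hM : ∀ k l, ∫ ω, Z (σ ω) k l ∂μ = M k l) :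
    ∫ ω, (Z (σ ω) * E (τ ω)).trace ∂μ = ∫ ω, (M * E (τ ω)).trace ∂μ := by
  have hE := fun k l => integrable_comp_of_finite hτ fun x => E x k l
  have hind : ∀ k l, IndepFun (fun ω => Z (σ ω) k l) (fun ω => E (τ ω) l k) μ := fun k l =>
    h.comp (φ := fun x => Z x k l) (ψ := fun x => E x l k) (measurable_of_finite _)
      (measurable_of_finite _)
  have hZ := fun k l => integrable_comp_of_finite hσ fun x => Z x k l
  have hZE : ∀ k l, Integrable (fun ω => Z (σ ω) k l * E (τ ω) l k) μ := fun k l =>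
    (hind k l).integrable_mul (hZ k l) (hE l k)
  have hME : ∀ k l, Integrable (fun ω => M k l * E (τ ω) l k) μ := fun k l =>
    (hE l k).const_mul _
  simp only [Matrix.trace, Matrix.diag_apply, Matrix.mul_apply]
  rw [integral_finsetSum _ fun k _ => integrable_finsetSum _ fun l _ =>
      hZE k l,
    integral_finsetSum _ fun k _ => integrable_finsetSum _ fun l _ => hME k l]
  refine Finset.sum_congr rfl fun k _ => ?_
  rw [integral_finsetSum _ fun l _ => hZE k l,
    integral_finsetSum _ fun l _ => hME k l]
  refine Finset.sum_congr rfl fun l _ => ?_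
  rw [(hind k l).integral_fun_mul_eq_mul_integral (hZ k l).1 (hE l k).1, integral_const_mul, hM]

theorem posSemidef_of_integral {σ : Ω → S} (hσ : AEMeasurable σ μ) {Z : S → Matrix ι ι ℝ}
    (hZ : ∀ s, (Z s).PosSemidef) {M : Matrix ι ι ℝ} (hM : ∀ j k, ∫ ω, Z (σ ω) j k ∂μ = M j k) :
    M.PosSemidef := by
  refine .of_dotProduct_mulVec_nonneg ?_ fun x => ?_
  · ext j k
    rw [Matrix.conjTranspose_apply, star_trivial, ← hM, ← hM]
    congr 1
    funext ω
    simpa using (hZ (σ ω)).isHermitian.apply j k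
  · have hint := fun j k => integrable_comp_of_finite hσ fun s => Z s j k
    have e : star x ⬝ᵥ M *ᵥ x = ∫ ω, star x ⬝ᵥ Z (σ ω) *ᵥ x ∂μ := by
      simp only [dotProduct, Matrix.mulVec, Finset.mul_sum]
      rw [integral_finsetSum _ fun j _ => integrable_finsetSum _ fun k _ =>
        ((hint j k).mul_const _).const_mul _]
      refine Finset.sum_congr rfl fun j _ => ?_
      rw [integral_finsetSum _ fun k _ => ((hint j k).mul_const _).const_mul _]
      refine Finset.sum_congr rfl fun k _ => ?_
      rw [integral_const_mul, integral_mul_const, hM]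
    rw [e]
    exact integral_nonneg fun ω => (hZ (σ ω)).dotProduct_mulVec_nonneg x

variable [DecidableEq ι]

/-- Moment bound behind the Chernoff inequality: each independent summand `Z (σ i)` with `0 ≤ Z ≤ R`
and mean at least `l` shrinks the expected trace exponential by the factor
`exp (-θ (1 - θ R / 2) l)`. -/
theorem integral_trace_exp_neg_sum_le {σ : κ → Ω → S} (hσ : ∀ i, AEMeasurable (σ i) μ)
    (hind : iIndepFun σ μ) {Z : S → Matrix ι ι ℝ} {M : Matrix ι ι ℝ} {R l θ : ℝ} (hR : 0 < R)
    (hZ : ∀ s, (Z s).PosSemidef) (hZR : ∀ s, (R • (1 : Matrix ι ι ℝ) - Z s).PosSemidef)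
    (hM : ∀ i j k, ∫ ω, Z (σ i ω) j k ∂μ = M j k)
    (hl : (M - l • (1 : Matrix ι ι ℝ)).PosSemidef) (hθ : 0 ≤ θ) (hθR : θ * R ≤ 2)
    (t : Finset κ) :
    ∫ ω, (NormedSpace.exp (-θ • ∑ i ∈ t, Z (σ i ω))).trace ∂μ ≤
      Fintype.card ι * Real.exp (-(θ * (1 - θ * R / 2) * l) * t.card) := by
  classical
  have hint : ∀ u : Finset κ,
      Integrable (fun ω => (NormedSpace.exp (-θ • ∑ i ∈ u, Z (σ i ω))).trace) μ := by
    intro u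
    have := integrable_comp_of_finite (μ := μ) (σ := fun ω (i : u) => σ i ω)
      (aemeasurable_pi_lambda _ fun i => hσ i)
      (fun x => (NormedSpace.exp (-θ • ∑ i : u, Z (x i))).trace)
    refine this.congr (.of_forall fun ω => ?_)
    simp only [Finset.sum_coe_sort u fun i => Z (σ i ω)]
  induction t using Finset.induction_on with
  | empty => simp
  | insert j t hj ih =>
    let τ : Ω → t → S := fun ω i => σ i ω
    have hτ : AEMeasurable τ μ := aemeasurable_pi_lambda _ fun i => hσ i
    let H : (t → S) → Matrix ι ι ℝ := fun x => -θ • ∑ i : t, Z (x i)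
    have hH : ∀ ω, H (τ ω) = -θ • ∑ i ∈ t, Z (σ i ω) := fun ω => by
      simp only [H, τ, Finset.sum_coe_sort t fun i => Z (σ i ω)]
    have hHh : ∀ x, (H x).IsHermitian := fun x =>
      (Matrix.posSemidef_sum _ fun i _ => hZ (x i)).isHermitian.smul (.all _)
    have hστ : IndepFun (σ j) τ μ := by
      have := hind.indepFun_finset₀ {j} t (by simpa using hj) hσ
      exact this.comp (φ := fun x : ({j} : Finset κ) → S => x ⟨j, by simp⟩) (ψ := id)
        (measurable_pi_apply _) measurable_id
    have hstep : ∀ ω, (NormedSpace.exp (-θ • ∑ i ∈ insert j t, Z (σ i ω))).trace ≤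
        (NormedSpace.exp (H (τ ω))).trace -
          (1 - θ * R / 2) * (θ * (Z (σ j ω) * NormedSpace.exp (H (τ ω))).trace) := by
      intro ω
      have e : -θ • ∑ i ∈ insert j t, Z (σ i ω) = H (τ ω) - θ • Z (σ j ω) := by
        rw [hH, Finset.sum_insert hj, smul_add, neg_smul, neg_smul]; abel
      have hsq : ((θ * R) • (θ • Z (σ j ω)) - (θ • Z (σ j ω)) * (θ • Z (σ j ω))).PosSemidef := by
        have := ((hZ (σ j ω)).smul_sub_mul_self hR (hZR _)).smul (mul_nonneg hθ hθ)
        convert this using 1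
        rw [Matrix.smul_mul, Matrix.mul_smul, smul_sub, smul_smul, smul_smul, smul_smul]
        congr 2
        ring
      have := Matrix.trace_exp_sub_le (hHh (τ ω)) ((hZ (σ j ω)).smul hθ)
        (mul_nonneg hθ hR.le) hsq
      rwa [← e, Matrix.smul_mul, Matrix.trace_smul, smul_eq_mul] at this
    have hintH : Integrable (fun ω => (NormedSpace.exp (H (τ ω))).trace) μ :=
      integrable_comp_of_finite hτ fun x => (NormedSpace.exp (H x)).trace
    have hintM : Integrable (fun ω => (M * NormedSpace.exp (H (τ ω))).trace) μ :=
      integrable_comp_of_finite hτ fun x => (M * NormedSpace.exp (H x)).trace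
    have hintZ : Integrable (fun ω => (Z (σ j ω) * NormedSpace.exp (H (τ ω))).trace) μ :=
      integrable_comp_of_finite ((hσ j).prodMk hτ)
        fun x => (Z x.1 * NormedSpace.exp (H x.2)).trace
    have hE0 : 0 ≤ ∫ ω, (NormedSpace.exp (H (τ ω))).trace ∂μ := integral_nonneg fun ω => by
      simpa using Matrix.PosSemidef.one.trace_mul_exp_nonneg (hHh (τ ω))
    have hlow : l * ∫ ω, (NormedSpace.exp (H (τ ω))).trace ∂μ ≤
        ∫ ω, (Z (σ j ω) * NormedSpace.exp (H (τ ω))).trace ∂μ := by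
      rw [integral_trace_mul_of_indepFun (hσ j) hτ hστ Z (fun x => NormedSpace.exp (H x)) (hM j),
        ← integral_const_mul]
      refine integral_mono (hintH.const_mul _) hintM fun ω => ?_
      have := hl.trace_mul_exp_nonneg (hHh (τ ω))
      rw [Matrix.sub_mul, Matrix.trace_sub, Matrix.smul_mul, Matrix.trace_smul, Matrix.one_mul,
        smul_eq_mul] at this
      exact sub_nonneg.1 this
    have ih' : ∫ ω, (NormedSpace.exp (H (τ ω))).trace ∂μ ≤
        Fintype.card ι * Real.exp (-(θ * (1 - θ * R / 2) * l) * t.card) := by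
      simpa only [hH] using ih
    calc ∫ ω, (NormedSpace.exp (-θ • ∑ i ∈ insert j t, Z (σ i ω))).trace ∂μ
        ≤ ∫ ω, ((NormedSpace.exp (H (τ ω))).trace -
          (1 - θ * R / 2) * (θ * (Z (σ j ω) * NormedSpace.exp (H (τ ω))).trace)) ∂μ :=
          integral_mono (hint _) (hintH.sub ((hintZ.const_mul _).const_mul _)) hstep
      _ = ∫ ω, (NormedSpace.exp (H (τ ω))).trace ∂μ -
          (1 - θ * R / 2) * (θ * ∫ ω, (Z (σ j ω) * NormedSpace.exp (H (τ ω))).trace ∂μ) := by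
          rw [integral_sub hintH ((hintZ.const_mul _).const_mul _), integral_const_mul,
            integral_const_mul]
      _ ≤ (1 - θ * (1 - θ * R / 2) * l) * ∫ ω, (NormedSpace.exp (H (τ ω))).trace ∂μ := by
          have h1 : 0 ≤ (1 - θ * R / 2) * θ := mul_nonneg (by linarith) hθ
          have := mul_le_mul_of_nonneg_left hlow h1
          linarith
      _ ≤ Real.exp (-(θ * (1 - θ * R / 2) * l)) * ∫ ω, (NormedSpace.exp (H (τ ω))).trace ∂μ := by
          refine mul_le_mul_of_nonneg_right ?_ hE0
          have := Real.add_one_le_exp (-(θ * (1 - θ * R / 2) * l))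
          linarith
      _ ≤ Real.exp (-(θ * (1 - θ * R / 2) * l)) *
          (Fintype.card ι * Real.exp (-(θ * (1 - θ * R / 2) * l) * t.card)) :=
          mul_le_mul_of_nonneg_left ih' (Real.exp_pos _).le
      _ = _ := by
          rw [Finset.card_insert_of_notMem hj, mul_left_comm, ← Real.exp_add]
          push_cast
          ring_nf

/-- Lower tail of the matrix Chernoff bound, at half of the mean: for independent random matrices
`0 ≤ Z (σ i) ≤ R` with finitely many values and common mean `M ≥ l`. -/
theorem matrix_chernoff_lower_tail [Fintype κ] {σ : κ → Ω → S} (hσ : ∀ i, AEMeasurable (σ i) μ)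
    (hind : iIndepFun σ μ) {Z : S → Matrix ι ι ℝ} {M : Matrix ι ι ℝ} {R l : ℝ} (hR : 0 < R)
    (hZ : ∀ s, (Z s).PosSemidef) (hZR : ∀ s, (R • (1 : Matrix ι ι ℝ) - Z s).PosSemidef)
    (hM : ∀ i j k, ∫ ω, Z (σ i ω) j k ∂μ = M j k)
    (hl : (M - l • (1 : Matrix ι ι ℝ)).PosSemidef) :
    μ.real {ω | ¬ (∑ i, Z (σ i ω) -
        (Fintype.card κ * l / 2) • (1 : Matrix ι ι ℝ)).PosSemidef} ≤
      Fintype.card ι * Real.exp (-(Fintype.card κ * l / (8 * R))) := by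
  set t : ℝ := Fintype.card κ * l / 2 with ht
  -- The exponent `θ t - θ (1 - θ R / 2) (2 t)` is smallest at this `θ`.
  set θ : ℝ := 1 / (2 * R) with hθ
  have hθ0 : 0 ≤ θ := by positivity
  have hθR : θ * R = 1 / 2 := by rw [hθ]; field_simp
  have hmom := integral_trace_exp_neg_sum_le hσ hind hR hZ hZR hM hl hθ0 (by rw [hθR]; norm_num)
    Finset.univ
  have hherm : ∀ ω, (∑ i, Z (σ i ω)).IsHermitian := fun ω =>
    (Matrix.posSemidef_sum _ fun i _ => hZ (σ i ω)).isHermitian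
  have hsub : {ω | ¬ (∑ i, Z (σ i ω) - t • (1 : Matrix ι ι ℝ)).PosSemidef} ⊆
      {ω | Real.exp (-θ * t) ≤ (NormedSpace.exp (-θ • ∑ i, Z (σ i ω))).trace} := fun ω hω =>
    ((hherm ω).posSemidef_sub_or_exp_le_trace t hθ0).resolve_left hω
  have hint : Integrable (fun ω => (NormedSpace.exp (-θ • ∑ i, Z (σ i ω))).trace) μ :=
    integrable_comp_of_finite (σ := fun ω i => σ i ω) (aemeasurable_pi_lambda _ hσ)
      (fun x => (NormedSpace.exp (-θ • ∑ i, Z (x i))).trace)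
  have hmarkov := mul_meas_ge_le_integral_of_nonneg
    (Filter.Eventually.of_forall fun ω => by
      simpa using Matrix.PosSemidef.one.trace_mul_exp_nonneg ((hherm ω).smul (.all (-θ))))
    hint (Real.exp (-θ * t))
  refine (measureReal_mono hsub).trans ?_
  rw [← mul_le_mul_iff_right₀ (Real.exp_pos (-θ * t))]
  refine (hmarkov.trans hmom).trans_eq ?_
  rw [mul_left_comm, ← Real.exp_add, Finset.card_univ, hθR, ht, hθ]
  congr 2
  field_simp
  ring

end ProbabilityTheory

/-! ### Optimal values: comparison, duality, interpolation -/

namespace GatedReLU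

variable {n d : ℕ}

theorem inner_toLp_mulVec (C : Matrix (Fin n) (Fin d) ℝ) (v : EuclideanSpace ℝ (Fin d))
    (z : EuclideanSpace ℝ (Fin n)) :
    inner ℝ (WithLp.toLp 2 (C *ᵥ v.ofLp)) z = inner ℝ v (WithLp.toLp 2 (Cᵀ *ᵥ z.ofLp)) := by
  simp only [EuclideanSpace.inner_eq_star_dotProduct, star_trivial]
  rw [Matrix.dotProduct_mulVec, ← Matrix.mulVec_transpose]

theorem norm_sq_toLp_transpose_mulVec (C : Matrix (Fin n) (Fin d) ℝ)
    (z : EuclideanSpace ℝ (Fin n)) :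
    ‖WithLp.toLp 2 (Cᵀ *ᵥ z.ofLp)‖ ^ 2 = z.ofLp ⬝ᵥ (C * Cᵀ) *ᵥ z.ofLp := by
  rw [← real_inner_self_eq_norm_sq, EuclideanSpace.inner_eq_star_dotProduct, star_trivial,
    ← Matrix.mulVec_mulVec, Matrix.dotProduct_mulVec z.ofLp, ← Matrix.mulVec_transpose]

theorem norm_sq_eq_dotProduct (z : EuclideanSpace ℝ (Fin n)) : ‖z‖ ^ 2 = z.ofLp ⬝ᵥ z.ofLp := by
  rw [← real_inner_self_eq_norm_sq, EuclideanSpace.inner_eq_star_dotProduct, star_trivial]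

theorem mul_norm_sq_le_of_posSemidef {A : Matrix (Fin n) (Fin n) ℝ} {t : ℝ}
    (h : (A - t • (1 : Matrix (Fin n) (Fin n) ℝ)).PosSemidef) (z : EuclideanSpace ℝ (Fin n)) :
    t * ‖z‖ ^ 2 ≤ z.ofLp ⬝ᵥ A *ᵥ z.ofLp := by
  have := h.dotProduct_mulVec_nonneg z.ofLp
  rw [star_trivial, Matrix.sub_mulVec, dotProduct_sub, Matrix.smul_mulVec, Matrix.one_mulVec,
    dotProduct_smul, smul_eq_mul, ← norm_sq_eq_dotProduct] at this
  exact sub_nonneg.1 this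

theorem dotProduct_le_mul_norm_sq_of_posSemidef {A : Matrix (Fin n) (Fin n) ℝ} {t : ℝ}
    (h : (t • (1 : Matrix (Fin n) (Fin n) ℝ) - A).PosSemidef) (z : EuclideanSpace ℝ (Fin n)) :
    z.ofLp ⬝ᵥ A *ᵥ z.ofLp ≤ t * ‖z‖ ^ 2 := by
  have := h.dotProduct_mulVec_nonneg z.ofLp
  rw [star_trivial, Matrix.sub_mulVec, dotProduct_sub, Matrix.smul_mulVec, Matrix.one_mulVec,
    dotProduct_smul, smul_eq_mul, ← norm_sq_eq_dotProduct] at this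
  exact sub_nonneg.1 this

section OptValue

variable {ι κ : Type*} [Fintype ι] [Fintype κ] (X : Matrix (Fin n) (Fin d) ℝ)
  (y : EuclideanSpace ℝ (Fin n)) {β : ℝ}

theorem objective_nonneg (hβ : 0 ≤ β) (D : ι → Matrix (Fin n) (Fin n) ℝ)
    (w : ι → EuclideanSpace ℝ (Fin d)) : 0 ≤ objective X y β D w := by
  unfold objective
  positivity

theorem optValue_nonneg (hβ : 0 ≤ β) (D : ι → Matrix (Fin n) (Fin n) ℝ) :
    0 ≤ optValue X y β D :=
  le_ciInf fun w => objective_nonneg X y hβ D w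

theorem optValue_le_objective (hβ : 0 ≤ β) (D : ι → Matrix (Fin n) (Fin n) ℝ)
    (w : ι → EuclideanSpace ℝ (Fin d)) : optValue X y β D ≤ objective X y β D w :=
  ciInf_le ⟨0, by rintro _ ⟨w, rfl⟩; exact objective_nonneg X y hβ D w⟩ w

/-- Repeating patterns or leaving some out does not decrease the optimal value: the weights of equal
patterns can be added up, which does not increase the penalty. -/
theorem optValue_le_optValue_comp (hβ : 0 ≤ β) (D : κ → Matrix (Fin n) (Fin n) ℝ) (f : ι → κ) :
    optValue X y β D ≤ optValue X y β (D ∘ f) := by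
  classical
  refine le_ciInf fun w => ?_
  refine (optValue_le_objective X y hβ D fun k => ∑ i with f i = k, w i).trans ?_
  have h1 : ∑ k, WithLp.toLp 2 ((D k * X) *ᵥ (∑ i with f i = k, w i).ofLp) =
      ∑ i, WithLp.toLp 2 (((D ∘ f) i * X) *ᵥ (w i).ofLp) := by
    rw [← Finset.sum_fiberwise _ f]
    refine Finset.sum_congr rfl fun k _ => ?_
    rw [WithLp.ofLp_sum, Matrix.mulVec_sum, WithLp.toLp_sum]
    refine Finset.sum_congr rfl fun i hi => ?_
    rw [← (Finset.mem_filter.1 hi).2]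
    rfl
  have h2 : ∑ k, ‖∑ i with f i = k, w i‖ ≤ ∑ i, ‖w i‖ := by
    rw [← Finset.sum_fiberwise _ f]
    exact Finset.sum_le_sum fun k _ => norm_sum_le _ _
  unfold objective
  rw [h1]
  gcongr

/-- The weights `w_i = (D_i X)ᵀ A⁻¹ y` with `A = ∑ i, D_i X (D_i X)ᵀ` interpolate `y`, and
`∑ i, ‖w_i‖² = yᵀ A⁻¹ y`. -/
theorem optValue_le_of_posSemidef (hβ : 0 ≤ β) (D : ι → Matrix (Fin n) (Fin n) ℝ) {t : ℝ}
    (ht : 0 < t)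
    (h : (∑ i, (D i * X) * (D i * X)ᵀ - t • (1 : Matrix (Fin n) (Fin n) ℝ)).PosSemidef) :
    optValue X y β D ≤ β * √(Fintype.card ι * (‖y‖ ^ 2 / t)) := by
  set A := ∑ i, (D i * X) * (D i * X)ᵀ with hA
  have hpd : A.PosDef := by
    have := Matrix.PosDef.posSemidef_add h (Matrix.PosDef.one.smul ht)
    rwa [sub_add_cancel] at this
  set z : EuclideanSpace ℝ (Fin n) := WithLp.toLp 2 (A⁻¹ *ᵥ y.ofLp) with hz
  have hAz : A *ᵥ z.ofLp = y.ofLp := by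
    rw [hz, Matrix.mulVec_mulVec,
      Matrix.mul_nonsing_inv _ ((Matrix.isUnit_iff_isUnit_det _).1 hpd.isUnit), Matrix.one_mulVec]
  set w : ι → EuclideanSpace ℝ (Fin d) := fun i => WithLp.toLp 2 ((D i * X)ᵀ *ᵥ z.ofLp) with hw
  have hfit : ∑ i, WithLp.toLp 2 ((D i * X) *ᵥ (w i).ofLp) = y := by
    rw [← WithLp.toLp_sum]
    simp only [hw, Matrix.mulVec_mulVec]
    rw [← Matrix.sum_mulVec, ← hA, hAz]
  have hsq : ∑ i, ‖w i‖ ^ 2 = inner ℝ z y := by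
    simp only [hw, norm_sq_toLp_transpose_mulVec]
    rw [← dotProduct_sum, ← Matrix.sum_mulVec, ← hA, hAz, EuclideanSpace.inner_eq_star_dotProduct,
      star_trivial, dotProduct_comm]
  have hzy : t * ‖z‖ ^ 2 ≤ inner ℝ z y := by
    have := mul_norm_sq_le_of_posSemidef h z
    rwa [hAz, dotProduct_comm, ← star_trivial z.ofLp, ← EuclideanSpace.inner_eq_star_dotProduct]
      at this
  have hcs : inner ℝ z y ≤ ‖z‖ * ‖y‖ := real_inner_le_norm z y
  have hbound : inner ℝ z y ≤ ‖y‖ ^ 2 / t := by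
    rw [le_div_iff₀ ht]
    nlinarith [sq_nonneg (t * ‖z‖ - ‖y‖), norm_nonneg z, norm_nonneg y]
  have hsum : ∑ i, ‖w i‖ ≤ √(Fintype.card ι * (‖y‖ ^ 2 / t)) := by
    refine Real.le_sqrt_of_sq_le ?_
    have := sq_sum_le_card_mul_sum_sq (s := Finset.univ) (f := fun i => ‖w i‖)
    rw [hsq, Finset.card_univ] at this
    exact this.trans (mul_le_mul_of_nonneg_left hbound (Nat.cast_nonneg _))
  refine (optValue_le_objective X y hβ D w).trans ?_
  unfold objective
  rw [hfit, sub_self, norm_zero]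
  simpa using mul_le_mul_of_nonneg_left hsum hβ

/-- Weak duality for the group-`ℓ¹` problem. -/
theorem le_optValue_of_dual_feasible (D : ι → Matrix (Fin n) (Fin n) ℝ)
    (v : EuclideanSpace ℝ (Fin n))
    (h : ∀ i, ‖WithLp.toLp 2 ((D i * X)ᵀ *ᵥ v.ofLp)‖ ≤ β) :
    inner ℝ y v - 1 / 2 * ‖v‖ ^ 2 ≤ optValue X y β D := by
  refine le_ciInf fun w => ?_
  unfold objective
  set r := ∑ i, WithLp.toLp 2 ((D i * X) *ᵥ (w i).ofLp) with hr
  have h1 : inner ℝ r v ≤ β * ∑ i, ‖w i‖ := by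
    rw [hr, sum_inner, Finset.mul_sum]
    refine Finset.sum_le_sum fun i _ => ?_
    rw [inner_toLp_mulVec, mul_comm]
    exact (real_inner_le_norm _ _).trans (mul_le_mul_of_nonneg_left (h i) (norm_nonneg _))
  have h2 := norm_add_sq_real (r - y) v
  rw [inner_sub_left] at h2
  linarith [sq_nonneg ‖r - y + v‖]

end OptValue

theorem pattern_transpose (X : Matrix (Fin n) (Fin d) ℝ) (u : EuclideanSpace ℝ (Fin d)) :
    (pattern X u)ᵀ = pattern X u :=
  Matrix.diagonal_transpose _

theorem gram_eq_mul_transpose (X : Matrix (Fin n) (Fin d) ℝ) {D : Matrix (Fin n) (Fin n) ℝ}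
    (hD : Dᵀ = D) : gram X D = (D * X) * (D * X)ᵀ := by
  rw [gram, Matrix.transpose_mul, hD, ← Matrix.mul_assoc]

theorem fullValue_le_sampledValue {m : ℕ} (X : Matrix (Fin n) (Fin d) ℝ)
    (y : EuclideanSpace ℝ (Fin n)) {β : ℝ} (hβ : 0 ≤ β) (g : Fin m → EuclideanSpace ℝ (Fin d)) :
    fullValue X y β ≤ sampledValue X y β g :=
  optValue_le_optValue_comp X y hβ (fun D : allPatterns X => (D : Matrix (Fin n) (Fin n) ℝ))
    fun i => ⟨pattern X (g i), g i, rfl⟩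

theorem sqrt_dotProduct_gram (X : Matrix (Fin n) (Fin d) ℝ) (y : EuclideanSpace ℝ (Fin n))
    (D : allPatterns X) : √(y.ofLp ⬝ᵥ gram X D *ᵥ y.ofLp) =
      ‖WithLp.toLp 2 (((D : Matrix (Fin n) (Fin n) ℝ) * X)ᵀ *ᵥ y.ofLp)‖ := by
  obtain ⟨_, u, rfl⟩ := D
  rw [gram_eq_mul_transpose X (pattern_transpose X u), ← norm_sq_toLp_transpose_mulVec,
    Real.sqrt_sq (norm_nonneg _)]

/-- Lower bound on the full optimal value from the dual point `c • y`, where `c = β / maxGram X y` is the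
largest multiple that is feasible. -/
theorem le_fullValue (X : Matrix (Fin n) (Fin d) ℝ) (y : EuclideanSpace ℝ (Fin n)) {β R : ℝ}
    (hβ : 0 ≤ β) (hR : 0 < R)
    (hgram : ∀ D ∈ allPatterns X, (R • (1 : Matrix (Fin n) (Fin n) ℝ) - gram X D).PosSemidef)
    (h : β < 2 * maxGram X y) : G X y β * (β * (‖y‖ / √R)) ≤ fullValue X y β := by
  have hμ : 0 < maxGram X y := by linarith
  have : Nonempty (allPatterns X) := ⟨⟨_, 0, rfl⟩⟩
  have hμR : maxGram X y ≤ √R * ‖y‖ := by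
    refine ciSup_le fun D => ?_
    rw [← Real.sqrt_sq (norm_nonneg y), ← Real.sqrt_mul hR.le]
    exact Real.sqrt_le_sqrt (dotProduct_le_mul_norm_sq_of_posSemidef (hgram D D.2) y)
  have hG : 0 < G X y β := by
    unfold G
    rw [sub_pos, div_lt_one (by linarith)]
    exact h
  set c := β / maxGram X y with hc
  have hc0 : 0 ≤ c := div_nonneg hβ hμ.le
  have hfeas := le_optValue_of_dual_feasible X y (β := β)
    (fun D : allPatterns X => (D : Matrix (Fin n) (Fin n) ℝ)) (c • y) fun D => by
      rw [WithLp.ofLp_smul, Matrix.mulVec_smul, WithLp.toLp_smul, norm_smul, Real.norm_of_nonneg hc0,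
        ← sqrt_dotProduct_gram, hc, div_mul_eq_mul_div, div_le_iff₀ hμ]
      exact mul_le_mul_of_nonneg_left (le_ciSup (f := fun D : allPatterns X =>
        √(y.ofLp ⬝ᵥ gram X D *ᵥ y.ofLp)) (Set.finite_range _).bddAbove D) hβ
  refine le_trans ?_ hfeas
  rw [inner_smul_right, real_inner_self_eq_norm_sq, norm_smul, Real.norm_of_nonneg hc0]
  have e : c * ‖y‖ ^ 2 - 1 / 2 * (c * ‖y‖) ^ 2 = G X y β * (β * (‖y‖ * (‖y‖ / maxGram X y))) := by
    unfold G
    rw [hc]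
    field_simp
  rw [e]
  refine mul_le_mul_of_nonneg_left (mul_le_mul_of_nonneg_left ?_ hβ) hG.le
  rw [div_eq_mul_inv]
  refine mul_le_mul_of_nonneg_left ?_ (norm_nonneg y)
  rw [inv_le_iff_one_le_mul₀ (Real.sqrt_pos.2 hR), div_mul_eq_mul_div, one_le_div hμ, mul_comm]
  exact hμR

/-! ### Extreme eigenvalues and the mean Gram matrix -/

theorem posSemidef_sub_lambdaMin {A : Matrix (Fin n) (Fin n) ℝ} (hA : A.IsHermitian) :
    (A - lambdaMin A • (1 : Matrix (Fin n) (Fin n) ℝ)).PosSemidef := by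
  have := hA.posSemidef_smul_add (c := 1) (t := -lambdaMin A) fun i => by
    have : lambdaMin A ≤ hA.eigenvalues i := by
      unfold lambdaMin
      rw [hA.spectrum_real_eq_range_eigenvalues]
      exact csInf_le (Set.finite_range _).bddBelow ⟨i, rfl⟩
    linarith
  rwa [one_smul, neg_smul, ← sub_eq_add_neg] at this

theorem posSemidef_lambdaMax_sub {A : Matrix (Fin n) (Fin n) ℝ} (hA : A.IsHermitian) :
    (lambdaMax A • (1 : Matrix (Fin n) (Fin n) ℝ) - A).PosSemidef := by
  have := hA.posSemidef_smul_add (c := -1) (t := lambdaMax A) fun i => by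
    have : hA.eigenvalues i ≤ lambdaMax A := by
      unfold lambdaMax
      rw [hA.spectrum_real_eq_range_eigenvalues]
      exact le_csSup (Set.finite_range _).bddAbove ⟨i, rfl⟩
    linarith
  rwa [neg_smul, one_smul, add_comm, ← sub_eq_add_neg] at this

theorem lambdaMin_pos (hn : 0 < n) {A : Matrix (Fin n) (Fin n) ℝ} (hA : A.PosDef) :
    0 < lambdaMin A := by
  have : Nonempty (Fin n) := ⟨⟨0, hn⟩⟩
  unfold lambdaMin
  rw [hA.isHermitian.spectrum_real_eq_range_eigenvalues]
  obtain ⟨i, hi⟩ := (Set.range_nonempty hA.isHermitian.eigenvalues).csInf_mem (Set.finite_range _)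
  rw [← hi]
  exact hA.eigenvalues_pos i

theorem lambdaMax_nonneg {A : Matrix (Fin n) (Fin n) ℝ} (hA : A.PosSemidef) : 0 ≤ lambdaMax A := by
  unfold lambdaMax
  rw [hA.isHermitian.spectrum_real_eq_range_eigenvalues]
  refine Real.sSup_nonneg ?_
  rintro _ ⟨i, rfl⟩
  exact hA.eigenvalues_nonneg i

theorem posSemidef_mul_transpose (X : Matrix (Fin n) (Fin d) ℝ) : (X * Xᵀ).PosSemidef := by
  rw [← Matrix.conjTranspose_eq_transpose_of_trivial]
  exact Matrix.posSemidef_self_mul_conjTranspose X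

/-- The activation pattern of `u` on `X` as a Boolean vector: an element of a finite measurable type,
which determines the matrix `pattern X u`. -/
noncomputable def signs (X : Matrix (Fin n) (Fin d) ℝ) (u : EuclideanSpace ℝ (Fin d)) :
    Fin n → Bool :=
  fun i => decide (0 ≤ (X *ᵥ u.ofLp) i)

/-- The diagonal `0`-`1` matrix of a Boolean vector, so that `mask (signs X u) = pattern X u`. -/
noncomputable def mask (s : Fin n → Bool) : Matrix (Fin n) (Fin n) ℝ :=
  Matrix.diagonal fun i => if s i = true then 1 else 0

theorem mask_transpose (s : Fin n → Bool) : (mask s)ᵀ = mask s :=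
  Matrix.diagonal_transpose _

theorem mask_signs (X : Matrix (Fin n) (Fin d) ℝ) (u : EuclideanSpace ℝ (Fin d)) :
    mask (signs X u) = pattern X u := by
  simp [mask, signs, pattern]

theorem measurable_signs (X : Matrix (Fin n) (Fin d) ℝ) : Measurable (signs X) := by
  refine measurable_pi_lambda _ fun i => measurable_to_bool ?_
  have : (fun u : EuclideanSpace ℝ (Fin d) => signs X u i) ⁻¹' {true} =
      {u | 0 ≤ (X *ᵥ u.ofLp) i} := by
    ext u
    simp [signs]
  rw [this]
  refine (isClosed_le continuous_const ?_).measurableSet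
  exact (continuous_apply i).comp
    (Continuous.matrix_mulVec continuous_const (PiLp.continuous_ofLp 2 _))

theorem posSemidef_gram_mask (X : Matrix (Fin n) (Fin d) ℝ) (s : Fin n → Bool) :
    (gram X (mask s)).PosSemidef := by
  rw [gram_eq_mul_transpose X (mask_transpose s)]
  exact posSemidef_mul_transpose _

theorem posSemidef_lambdaMax_sub_gram_mask (X : Matrix (Fin n) (Fin d) ℝ) (s : Fin n → Bool) :
    (lambdaMax (X * Xᵀ) • (1 : Matrix (Fin n) (Fin n) ℝ) - gram X (mask s)).PosSemidef := by
  have hX := posSemidef_mul_transpose X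
  have h1 := (posSemidef_lambdaMax_sub hX.isHermitian).conjTranspose_mul_mul_same (mask s)
  have h2 : (1 - mask s : Matrix (Fin n) (Fin n) ℝ).PosSemidef := by
    rw [mask, ← Matrix.diagonal_one, Matrix.diagonal_sub]
    refine Matrix.PosSemidef.diagonal fun i => ?_
    by_cases h : s i = true <;> simp [h]
  have hT : (mask s)ᴴ = mask s := by
    rw [Matrix.conjTranspose_eq_transpose_of_trivial, mask_transpose]
  have hsq : mask s * mask s = mask s := by
    simp [mask, Matrix.diagonal_mul_diagonal]
  rw [hT] at h1
  convert h1.add (h2.smul (lambdaMax_nonneg hX)) using 1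
  rw [gram, Matrix.mul_sub, Matrix.sub_mul, Matrix.mul_smul, Matrix.smul_mul, Matrix.mul_one, hsq,
    smul_sub, ← Matrix.mul_assoc]
  abel

theorem integral_gram_mask_signs {Ω : Type*} [MeasurableSpace Ω] {μ : Measure Ω}
    (X : Matrix (Fin n) (Fin d) ℝ) {g : Ω → EuclideanSpace ℝ (Fin d)}
    (hg : HasLaw g (stdGaussian (EuclideanSpace ℝ (Fin d))) μ) (j k : Fin n) :
    ∫ ω, gram X (mask (signs X (g ω))) j k ∂μ = meanGram X j k := by
  have hmeas : Measurable fun u => gram X (mask (signs X u)) j k :=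
    (measurable_of_finite fun s => gram X (mask s) j k).comp (measurable_signs X)
  have := hg.integral_comp hmeas.aestronglyMeasurable
  simp only [Function.comp_def] at this
  rw [this]
  simp only [mask_signs, meanGram, Matrix.of_apply]

theorem meanGram_posSemidef (X : Matrix (Fin n) (Fin d) ℝ) : (meanGram X).PosSemidef :=
  posSemidef_of_integral (measurable_signs X).aemeasurable (posSemidef_gram_mask X)
    (integral_gram_mask_signs X HasLaw.id)

theorem lambdaMin_meanGram_le (hn : 0 < n) (X : Matrix (Fin n) (Fin d) ℝ) :
    lambdaMin (meanGram X) ≤ lambdaMax (X * Xᵀ) := by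
  let i : Fin n := ⟨0, hn⟩
  have h1 := (posSemidef_sub_lambdaMin (meanGram_posSemidef X).isHermitian).diag_nonneg (i := i)
  have h2 : meanGram X i i ≤ lambdaMax (X * Xᵀ) := by
    have hint := integrable_comp_of_finite
      (μ := stdGaussian (EuclideanSpace ℝ (Fin d))) (measurable_signs X).aemeasurable
      fun s => gram X (mask s) i i
    rw [← integral_gram_mask_signs X HasLaw.id]
    refine (integral_mono hint (integrable_const (lambdaMax (X * Xᵀ))) fun u => ?_).trans_eq
      (by simp)
    simpa using (posSemidef_lambdaMax_sub_gram_mask X (signs X u)).diag_nonneg (i := i)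
  simp at h1
  linarith

theorem sampledValue_le {m : ℕ} (hm : 0 < m) (X : Matrix (Fin n) (Fin d) ℝ)
    (y : EuclideanSpace ℝ (Fin n)) {β l : ℝ} (hβ : 0 ≤ β) (hl : 0 < l)
    (g : Fin m → EuclideanSpace ℝ (Fin d))
    (h : (∑ i, gram X (pattern X (g i)) -
      (m * l / 2) • (1 : Matrix (Fin n) (Fin n) ℝ)).PosSemidef) :
    sampledValue X y β g ≤ √2 * β * (‖y‖ / √l) := by
  have hm' : (0 : ℝ) < m := Nat.cast_pos.2 hm
  simp only [gram_eq_mul_transpose X (pattern_transpose X _)] at h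
  refine (optValue_le_of_posSemidef X y hβ _ (by positivity) h).trans_eq ?_
  have e : (Fintype.card (Fin m) : ℝ) * (‖y‖ ^ 2 / (m * l / 2)) = 2 * (‖y‖ ^ 2 / l) := by
    rw [Fintype.card_fin]
    field_simp
  rw [e, Real.sqrt_mul (by norm_num), Real.sqrt_div (sq_nonneg _), Real.sqrt_sq (norm_nonneg y)]
  ring

end GatedReLU

/-! ### Approximation by sampled patterns -/

open GatedReLU in
theorem theorem3p8 {n d : ℕ} (hn : 0 < n) (X : Matrix (Fin n) (Fin d) ℝ)
    (y : EuclideanSpace ℝ (Fin n)) (β : ℝ) (hβ : 0 ≤ β) (δ : ℝ) (hδ : 0 < δ)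
    (hM : IsUnit (GatedReLU.meanGram X))
    (m : ℕ) (hm : 8 * GatedReLU.kappa X * Real.log (n / δ) ≤ m)
    {Ω : Type*} [MeasurableSpace Ω] (μ : Measure Ω) [IsProbabilityMeasure μ]
    (g : Fin m → Ω → EuclideanSpace ℝ (Fin d))
    (hlaw : ∀ i, HasLaw (g i) (stdGaussian (EuclideanSpace ℝ (Fin d))) μ)
    (hindep : iIndepFun g μ) :
    1 - δ ≤ μ.real {ω |
      (0 ≤ GatedReLU.sampledValue X y β (fun i => g i ω) - GatedReLU.fullValue X y β ∧
        GatedReLU.sampledValue X y β (fun i => g i ω) - GatedReLU.fullValue X y β ≤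
          √2 * β * (‖y‖ / √(GatedReLU.lambdaMin (GatedReLU.meanGram X)))) ∧
      (β < 2 * GatedReLU.maxGram X y →
        GatedReLU.fullValue X y β ≤ GatedReLU.sampledValue X y β (fun i => g i ω) ∧
        GatedReLU.sampledValue X y β (fun i => g i ω) ≤
          √(2 * GatedReLU.kappa X) / GatedReLU.G X y β * GatedReLU.fullValue X y β)} := by
  set l := lambdaMin (meanGram X) with hl
  set R := lambdaMax (X * Xᵀ) with hR
  have hl0 : 0 < l := lambdaMin_pos hn ((meanGram_posSemidef X).posDef_iff_isUnit.2 hM)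
  have hR0 : 0 < R := hl0.trans_le (lambdaMin_meanGram_le hn X)
  have hκ : kappa X = R / l := rfl
  have hκ0 : 0 < kappa X := div_pos hR0 hl0
  have hn' : (0 : ℝ) < n := Nat.cast_pos.2 hn
  rcases Nat.eq_zero_or_pos m with rfl | hm0
  -- Without samples the bound on `m` forces `n ≤ δ`.
  · have h1 : Real.log (n / δ) ≤ 0 := by
      by_contra! h
      have := mul_pos (mul_pos (by norm_num : (0 : ℝ) < 8) hκ0) h
      simp only [Nat.cast_zero] at hm
      linarith
    have h2 : (n : ℝ) ≤ δ := by
      have := (Real.log_nonpos_iff (by positivity)).1 h1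
      rwa [div_le_one hδ] at this
    have h3 : (1 : ℝ) ≤ n := by exact_mod_cast hn
    exact (by linarith : 1 - δ ≤ 0).trans measureReal_nonneg
  have hchernoff := matrix_chernoff_lower_tail (σ := fun i ω => signs X (g i ω))
    (fun i => (measurable_signs X).comp_aemeasurable (hlaw i).aemeasurable)
    (hindep.comp (fun _ => signs X) fun _ => measurable_signs X) hR0 (posSemidef_gram_mask X)
    (posSemidef_lambdaMax_sub_gram_mask X) (fun i => integral_gram_mask_signs X (hlaw i))
    (posSemidef_sub_lambdaMin (meanGram_posSemidef X).isHermitian)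
  simp only [mask_signs, Fintype.card_fin] at hchernoff
  have hδ' : (n : ℝ) * Real.exp (-(m * l / (8 * R))) ≤ δ := by
    have h1 : Real.log (n / δ) ≤ m * l / (8 * R) := by
      rw [le_div_iff₀ (by positivity)]
      rw [hκ] at hm
      have := mul_le_mul_of_nonneg_right hm hl0.le
      have e : 8 * (R / l) * Real.log (n / δ) * l = Real.log (n / δ) * (8 * R) := by
        field_simp
      rwa [e] at this
    have h2 := (Real.log_le_iff_le_exp (by positivity)).1 h1
    rw [Real.exp_neg, mul_inv_le_iff₀ (Real.exp_pos _)]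
    rwa [div_le_iff₀ hδ, mul_comm] at h2
  set good : Set Ω := {ω | (∑ i, gram X (pattern X (g i ω)) -
    (m * l / 2) • (1 : Matrix (Fin n) (Fin n) ℝ)).PosSemidef} with hgood
  have hprob : 1 - δ ≤ μ.real good := by
    have h1 : μ.real (good ∪ goodᶜ) ≤ μ.real good + μ.real goodᶜ := measureReal_union_le _ _
    rw [Set.union_compl_self, probReal_univ] at h1
    have h2 : μ.real goodᶜ ≤ δ := hchernoff.trans hδ'
    linarith
  refine hprob.trans (measureReal_mono fun ω hω => ?_)
  have hup := sampledValue_le hm0 X y hβ hl0 (fun i => g i ω) hω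
  have hle := fullValue_le_sampledValue X y hβ fun i => g i ω
  have h0 : 0 ≤ fullValue X y β := optValue_nonneg X y hβ _
  refine ⟨⟨sub_nonneg.2 hle, by linarith⟩, fun h => ⟨hle, hup.trans ?_⟩⟩
  have hlow := le_fullValue X y hβ hR0 (fun D hD => by
    obtain ⟨u, rfl⟩ := hD
    rw [← mask_signs]
    exact posSemidef_lambdaMax_sub_gram_mask X _) h
  have hG : 0 < G X y β := by
    have : 0 < maxGram X y := by linarith
    rw [G, sub_pos, div_lt_one (by linarith)]
    exact h
  have hsR := Real.sqrt_pos.2 hR0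
  have hsl := Real.sqrt_pos.2 hl0
  calc √2 * β * (‖y‖ / √l)
      = √(2 * kappa X) / G X y β * (G X y β * (β * (‖y‖ / √R))) := by
        rw [hκ, Real.sqrt_mul (by norm_num), Real.sqrt_div hR0.le]
        field_simp
    _ ≤ _ := mul_le_mul_of_nonneg_left hlow (by positivity)
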